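/- Let $G$ be a totally disconnected locally compact (Hausdorff) topological group, let $\phi\colon G\to G$ be a continuous endomorphism, and let $H$ be a closed subgroup of $G$ that is $\phi$-stable, i.e. $\phi(H)=H$, and satisfies $\ker(\phi)\le H$. Suppose that $H$ is normal in $G$ or compact. Then $$h_{top}(\phi)=h_{top}(\phi\restriction_H)+h_{top}(\bar\phi)\qquad\text{in }[0,+\infty],$$ where $\phi\restriction_H\colon H\to H$ is the restriction of $\phi$, $G/H$ is the space of left cosets, and $\bar\phi\colon G/H\to G/H$, $xH\mapsto\phi(x)H$, is the map induced by $\phi$. Here $h_{top}$ is Hood's uniform entropy: for a uniformly continuous self-map $f$ of a uniform space $X$, $$h_{top}(f)=\sup_{K}\ \sup_{U}\ \limsup_{n\to\infty}\frac{\log r_n(f,U,K)}{n},$$ where $K$ runs over the compact subsets of $X$, $U$ runs over the entourages of $X$, and $r_n(f,U,K)$ is the least cardinality of a set $E\subseteq X$ such that for every $x\in K$ there is $e\in E$ with $(f^k(x),f^k(e))\in U$ for all $0\le k<n$. The groups $G$ and $H$ carry their left uniformities, with fundamental entourages $\{(x,y): y^{-1}x\in V\}$, and $G/H$ carries the left uniformity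 with fundamental entourages $\{(xH,yH): y^{-1}x\in V\}$, where $V$ runs over the neighbourhoods of $1$ (in $H$, respectively in $G$). -/

import Mathlib

open Filter Topology Uniformity SetRel

/-- Hood's (uniform) topological entropy of a self-map `f` of a uniform space `X`: the supremum,
over all compact subsets `K` of `X` and all entourages `U`, of the exponential growth rate (with a
`limsup`) of the least number of points of an `(n, U)`-spanning set for `K`, that is, of a set `E`
such that each `x ∈ K` satisfies, for some `e ∈ E`, that `f^[k] x` and `f^[k] e` are `U`-close
for all `k < n`. `Dynamics.coverEntropy f K` is the supremum over `U` for a fixed `K`. -/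
noncomputable def hoodEntropy {X : Type*} [UniformSpace X] (f : X → X) : EReal :=
  ⨆ (K : Set X) (_ : IsCompact K), Dynamics.coverEntropy f K

/-- For a normal or compact subgroup `H`, every neighbourhood `K` of `1` contains `h * l * h⁻¹`
up to right multiplication by `H`, for all `h ∈ H` and all `l` in some neighbourhood `L`
of `1`, i.e. `H L ⊆ K H`. -/
theorem exists_nhds_mul_subset {G : Type*} [Group G] [TopologicalSpace G] [IsTopologicalGroup G]
    {H : Subgroup G} (hH : H.Normal ∨ IsCompact (H : Set G)) {K : Set G} (hK : K ∈ 𝓝 (1 : G)) :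
    ∃ L ∈ 𝓝 (1 : G), ∀ h ∈ H, ∀ l ∈ L, ∃ k ∈ K, ∃ h' ∈ H, h * l = k * h' := by
  rcases hH with hN | hC
  · refine ⟨K, hK, fun h hh l hl => ⟨l, hl, l⁻¹ * h * l, ?_, by group⟩⟩
    simpa using hN.conj_mem h hh l⁻¹
  · have key : ∀ᶠ l in 𝓝 (1 : G), ∀ h ∈ (H : Set G), h * l * h⁻¹ ∈ K := by
      refine hC.eventually_forall_of_forall_eventually fun h _ => ?_
      have hcont : Continuous fun p : G × G => p.2 * p.1 * p.2⁻¹ := by fun_prop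
      have := hcont.tendsto ((1 : G), h)
      simp only [mul_one, mul_inv_cancel] at this
      exact this hK
    exact ⟨_, key, fun h hh l hl => ⟨h * l * h⁻¹, hl h hh, h, hh, by group⟩⟩

/-- The left uniformity of the space `G ⧸ H` of left cosets, for `H` normal or compact: a
fundamental system of entourages is given by the sets of all pairs `(xH, yH)` with `x⁻¹ * y ∈ K`,
where `K` is a neighbourhood of `1`, i.e. by the images of the entourages of the left uniformity
of `G`. Its topology is the quotient topology. -/
@[reducible] def quotientLeftUniformSpace {G : Type*} [Group G] [TopologicalSpace G]
    [IsTopologicalGroup G] (H : Subgroup G) (hH : H.Normal ∨ IsCompact (H : Set G)) :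
    UniformSpace (G ⧸ H) where
  toTopologicalSpace := inferInstance
  uniformity := Filter.map (Prod.map (QuotientGroup.mk (s := H)) (QuotientGroup.mk (s := H)))
    (@uniformity G (IsTopologicalGroup.leftUniformSpace G))
  symm := by
    let _ : UniformSpace G := IsTopologicalGroup.leftUniformSpace G
    rw [Filter.tendsto_map'_iff]
    exact (Filter.tendsto_map (f := Prod.map (QuotientGroup.mk (s := H))
      (QuotientGroup.mk (s := H)))).comp (tendsto_swap_uniformity (α := G))
  comp := by
    intro W hW
    obtain ⟨K, hK, hKW⟩ := Filter.mem_comap.1 (Filter.mem_map.1 hW)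
    obtain ⟨V, hV, hVK⟩ := exists_nhds_one_split hK
    obtain ⟨L, hL, hLV⟩ := exists_nhds_mul_subset hH hV
    refine Filter.mem_of_superset (Filter.mem_lift' (t := Prod.map (QuotientGroup.mk (s := H))
      (QuotientGroup.mk (s := H)) '' ((fun p : G × G => p.1⁻¹ * p.2) ⁻¹' (V ∩ L)))
      (Filter.image_mem_map (Filter.preimage_mem_comap (Filter.inter_mem hV hL)))) ?_
    rintro ⟨a, c⟩ ⟨b, ⟨⟨x, y⟩, hxy, h1⟩, ⟨⟨y', z⟩, hyz, h2⟩⟩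
    simp only [Prod.map_apply, Prod.mk.injEq] at h1 h2
    obtain ⟨rfl, hb⟩ := h1
    obtain ⟨hb', rfl⟩ := h2
    have hmem : y⁻¹ * y' ∈ H := QuotientGroup.eq.1 (hb.trans hb'.symm)
    obtain ⟨k, hk, h', hh', he⟩ := hLV _ hmem (y'⁻¹ * z) hyz.2
    have hz : (QuotientGroup.mk z : G ⧸ H) = QuotientGroup.mk (y * k) := by
      refine (QuotientGroup.eq.2 ?_).symm
      have : (y * k)⁻¹ * z = h' := by
        have h3 : z = y * (k * h') := by rw [← he]; group
        rw [h3]; group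
      rwa [this]
    have : (x, y * k) ∈ Prod.map (QuotientGroup.mk (s := H)) (QuotientGroup.mk (s := H)) ⁻¹' W := by
      refine hKW ?_
      have := hVK _ hxy.1 _ hk
      simpa [mul_assoc] using this
    rw [hz]
    exact this
  nhds_eq_comap_uniformity := by
    intro q
    obtain ⟨x, rfl⟩ := QuotientGroup.mk_surjective q
    let _ : UniformSpace G := IsTopologicalGroup.leftUniformSpace G
    rw [QuotientGroup.nhds_eq]
    apply le_antisymm
    · rw [← Filter.map_le_iff_le_comap, Filter.map_map]
      have : (Prod.mk (QuotientGroup.mk x : G ⧸ H)) ∘ (QuotientGroup.mk (s := H)) =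
          Prod.map (QuotientGroup.mk (s := H)) (QuotientGroup.mk (s := H)) ∘ Prod.mk x := rfl
      rw [this, ← Filter.map_map]
      refine Filter.map_mono ?_
      rw [nhds_eq_comap_uniformity, Filter.map_le_iff_le_comap]
    · intro S hS
      rw [Filter.mem_map, nhds_eq_comap_uniformity] at hS
      obtain ⟨W, hW, hWS⟩ := hS
      obtain ⟨K, hK, hKW⟩ := Filter.mem_comap.1 hW
      obtain ⟨L, hL, hLK⟩ := exists_nhds_mul_subset hH hK
      refine ⟨_, Filter.image_mem_map (Filter.preimage_mem_comap hL), ?_⟩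
      rintro c ⟨⟨x', z⟩, hxz, he⟩
      simp only [Prod.map_apply, Prod.mk.injEq] at he
      obtain ⟨hx, rfl⟩ := he
      obtain ⟨k, hk, h', hh', hkh⟩ := hLK _ (QuotientGroup.eq.1 hx.symm) (x'⁻¹ * z) hxz
      have hz : (QuotientGroup.mk z : G ⧸ H) = QuotientGroup.mk (x * k) := by
        refine (QuotientGroup.eq.2 ?_).symm
        have : (x * k)⁻¹ * z = h' := by
          have h3 : z = x * (k * h') := by rw [← hkh]; group
          rw [h3]; group
        rwa [this]
      have : x * k ∈ QuotientGroup.mk (s := H) ⁻¹' S := by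
        refine hWS (hKW ?_)
        simpa using hk
      rw [hz]
      exact this

/-- The restriction `φ|_H : H → H` of an endomorphism with `φ H ≤ H`. -/
def restrictMap {G : Type*} [Group G] (φ : G →* G) (H : Subgroup G) (hφ : H.map φ ≤ H) :
    H → H :=
  fun x => ⟨φ x, hφ (Subgroup.mem_map_of_mem φ x.2)⟩

/-- The map `xH ↦ φ(x)H` induced on `G ⧸ H` by an endomorphism with `φ H ≤ H`. -/
def quotientMap {G : Type*} [Group G] (φ : G →* G) (H : Subgroup G) (hφ : H.map φ ≤ H) :
    G ⧸ H → G ⧸ H :=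
  Quotient.map' φ fun x y hxy => by
    rw [QuotientGroup.leftRel_apply] at hxy ⊢
    have := hφ (Subgroup.mem_map_of_mem φ hxy)
    simpa using this

/-! Write `C_n(W)` for the subgroup of points whose first `n` iterates lie in `W`. If the uniformity
has a basis of subgroups `W` with compact image, then `(n, W)`-closeness means lying in one coset of
`C_n(W)`, so the entropy is the supremum over `W` of the growth rate of `[W : C_n(W)]`
(`hoodEntropy_eq`). This applies to `G`, `H` and `G ⧸ H`, with basic subgroups `U`, `U ∩ H` and
`UH`, where `U` is compact open and, unless `H` is normal, normalized by `H`.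

The ratios `[C_n(W) : C_{n+1}(W)]` are indices inside the decreasing groups `φ^n(C_n(W))`, hence
decrease to an integer `α`, and the growth rate is a true limit `log α`.

For `≥`, one has `[U : C_n(U)] ≥ [U ∩ H : C_n(U ∩ H)] * [UH : C_n(UH)]`. Since the rates are limits,
they add.

For `≤`, let `A` be the set of points of `U` with backward orbits of every finite length in `U`.
Compactness gives `A ≤ φ(A)` and `[φ(A) : A] = α`, a formula without limits
(`relIndex_map_backwardCore`). This index factors exactly as `[φ(A) ∩ H : A ∩ H] * [φ(A)H : AH]`.
Because `φ(A ∩ H) = φ(A) ∩ H` and `φ(AH) = φ(A)H`, both factors have the form `[φ(D) : D]` with `D ≤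
φ(D)`, and `log_relIndex_le_hoodEntropy` bounds their logarithms by the entropies on `H` and on `G ⧸
H`. -/

open scoped Pointwise

/-! ### Indices and orbits of subgroups under an endomorphism. -/

namespace Subgroup

variable {G : Type*} [Group G]

/-- The relative index of `U` in `K` does not change on passing to a subgroup `K'` of `K` that
meets every left coset of `U` which `K` meets. -/
theorem relIndex_eq_of_forall_exists {U K K' : Subgroup G} (h : K' ≤ K)
    (hex : ∀ x ∈ K, ∃ z ∈ K', x⁻¹ * z ∈ U) : U.relIndex K' = U.relIndex K := by
  refine Nat.card_congr (Equiv.ofBijective (quotientSubgroupOfEmbeddingOfLE U h)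
    ⟨(quotientSubgroupOfEmbeddingOfLE U h).injective, fun q => ?_⟩)
  obtain ⟨x, rfl⟩ := QuotientGroup.mk_surjective q
  obtain ⟨z, hz, hxz⟩ := hex x x.2
  refine ⟨QuotientGroup.mk ⟨z, hz⟩, Eq.symm (QuotientGroup.eq.2 ?_)⟩
  simpa [mem_subgroupOf] using hxz

/-- Converse for finite index: an injection between finite coset spaces of equal size is onto. -/
theorem forall_exists_of_relIndex_eq {U K K' : Subgroup G} (h : K' ≤ K) (h0 : U.relIndex K ≠ 0)
    (he : U.relIndex K' = U.relIndex K) : ∀ x ∈ K, ∃ z ∈ K', x⁻¹ * z ∈ U := by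
  intro x hx
  have : Finite (K ⧸ U.subgroupOf K) := Nat.finite_of_card_ne_zero h0
  obtain ⟨q, hq⟩ := ((quotientSubgroupOfEmbeddingOfLE U h).injective.bijective_of_nat_card_le
    he.ge).2 (QuotientGroup.mk ⟨x, hx⟩)
  obtain ⟨z, rfl⟩ := QuotientGroup.mk_surjective q
  refine ⟨z, z.2, ?_⟩
  simpa [mem_subgroupOf] using QuotientGroup.eq.1 hq.symm

theorem relIndex_comap_iterate (φ : G →* G) (n : ℕ) (A K : Subgroup G) :
    ((comap φ)^[n] A).relIndex K = A.relIndex ((map φ)^[n] K) := by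
  induction n generalizing K with
  | zero => rfl
  | succ n ih => rw [Function.iterate_succ_apply', relIndex_comap, ih, Function.iterate_succ_apply]

theorem map_inf_comap (φ : G →* G) (A B : Subgroup G) :
    (A ⊓ B.comap φ).map φ = A.map φ ⊓ B := by
  apply SetLike.coe_injective
  simp [Set.image_inter_preimage]

theorem map_iterate_inf_comap_iterate (φ : G →* G) (n : ℕ) (A B : Subgroup G) :
    (map φ)^[n] (A ⊓ (comap φ)^[n] B) = (map φ)^[n] A ⊓ B := by
  induction n generalizing A with
  | zero => rfl
  | succ n ih =>
    rw [Function.iterate_succ_apply, Function.iterate_succ_apply' (comap φ), map_inf_comap, ih,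
      Function.iterate_succ_apply]

theorem map_iterate_mono (φ : G →* G) (n : ℕ) : Monotone ((map φ)^[n]) :=
  Monotone.iterate (fun _ _ h => map_mono h) n

/-- The subgroup of all `x` such that `φ^[k] x ∈ W` for all `k < n`. -/
def orbitCore (φ : G →* G) (W : Subgroup G) : ℕ → Subgroup G
  | 0 => ⊤
  | n + 1 => W ⊓ (orbitCore φ W n).comap φ

theorem mem_orbitCore (φ : G →* G) (W : Subgroup G) (n : ℕ) (x : G) :
    x ∈ orbitCore φ W n ↔ ∀ k < n, φ^[k] x ∈ W := by
  induction n generalizing x with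
  | zero => simp [orbitCore]
  | succ n ih =>
    simp only [orbitCore, mem_inf, mem_comap, ih]
    refine ⟨fun h k hk => ?_, fun h => ⟨h 0 n.succ_pos, fun k hk => h (k + 1) (by omega)⟩⟩
    cases k with
    | zero => exact h.1
    | succ k => exact h.2 k (by omega)

theorem orbitCore_one (φ : G →* G) (W : Subgroup G) : orbitCore φ W 1 = W := by
  simp [orbitCore]

theorem orbitCore_mono_left (φ : G →* G) {W W' : Subgroup G} (h : W ≤ W') (n : ℕ) :
    orbitCore φ W n ≤ orbitCore φ W' n := fun x hx =>
  (mem_orbitCore φ W' n x).2 fun k hk => h ((mem_orbitCore φ W n x).1 hx k hk)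

theorem orbitCore_antitone (φ : G →* G) (W : Subgroup G) : Antitone (orbitCore φ W) :=
  fun _ _ h x hx => (mem_orbitCore φ W _ x).2 fun k hk =>
    (mem_orbitCore φ W _ x).1 hx k (hk.trans_le h)

theorem orbitCore_succ_le (φ : G →* G) (W : Subgroup G) (n : ℕ) : orbitCore φ W (n + 1) ≤ W :=
  inf_le_left

theorem mem_comap_iterate (φ : G →* G) (W : Subgroup G) (n : ℕ) (x : G) :
    x ∈ (comap φ)^[n] W ↔ φ^[n] x ∈ W := by
  induction n generalizing x with
  | zero => rfl
  | succ n ih => rw [Function.iterate_succ_apply', mem_comap, ih, Function.iterate_succ_apply]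

theorem orbitCore_succ (φ : G →* G) (W : Subgroup G) (n : ℕ) :
    orbitCore φ W (n + 1) = orbitCore φ W n ⊓ (comap φ)^[n] W := by
  ext x
  simp only [mem_inf, mem_orbitCore, mem_comap_iterate, Nat.lt_succ_iff_lt_or_eq]
  grind

theorem le_orbitCore (φ : G →* G) {W H : Subgroup G} (hW : H ≤ W) (hH : H.map φ ≤ H) (n : ℕ) :
    H ≤ orbitCore φ W n := by
  induction n with
  | zero => exact le_top
  | succ n ih => exact le_inf hW ((map_le_iff_le_comap.1 hH).trans (comap_mono ih))

/-- The subgroup of all `φ^[n] x`, where `φ^[k] x ∈ W` for all `k < n`. -/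
def orbitImage (φ : G →* G) (W : Subgroup G) (n : ℕ) : Subgroup G :=
  (map φ)^[n] (orbitCore φ W n)

theorem map_iterate_orbitCore_succ (φ : G →* G) (W : Subgroup G) (n : ℕ) :
    (map φ)^[n] (orbitCore φ W (n + 1)) = orbitImage φ W n ⊓ W := by
  rw [orbitCore_succ, map_iterate_inf_comap_iterate, orbitImage]

theorem orbitImage_succ (φ : G →* G) (W : Subgroup G) (n : ℕ) :
    orbitImage φ W (n + 1) = (orbitImage φ W n ⊓ W).map φ := by
  rw [orbitImage, Function.iterate_succ_apply', map_iterate_orbitCore_succ]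

theorem orbitImage_antitone (φ : G →* G) (W : Subgroup G) : Antitone (orbitImage φ W) := by
  refine antitone_nat_of_succ_le fun n => ?_
  rw [orbitImage, Function.iterate_succ_apply]
  refine map_iterate_mono φ n ?_
  rw [orbitCore, map_inf_comap]
  exact inf_le_right

/-- The step from `n + 1` to `n + 2` intersects with `φ^{-(n+1)}(W)`, and applying `φ^{n+1}` carries
that index to the orbit image. -/
theorem relIndex_orbitCore_succ_succ (φ : G →* G) (W : Subgroup G) (n : ℕ) :
    (orbitCore φ W (n + 2)).relIndex W =
      W.relIndex (orbitImage φ W (n + 1)) * (orbitCore φ W (n + 1)).relIndex W := by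
  rw [← relIndex_mul_relIndex _ _ _ (orbitCore_antitone φ W (n + 1).le_succ)
    (orbitCore_succ_le φ W n), orbitCore_succ φ W (n + 1), inf_relIndex_left,
    relIndex_comap_iterate, orbitImage]

theorem orbitImage_succ_of_le_map (φ : G →* G) {D : Subgroup G} (hD : D ≤ D.map φ) (n : ℕ) :
    orbitImage φ D (n + 1) = D.map φ := by
  induction n with
  | zero => simp [orbitImage, orbitCore]
  | succ n ih => rw [orbitImage_succ, ih, inf_of_le_right hD]

theorem relIndex_orbitCore_of_le_map (φ : G →* G) {D : Subgroup G} (hD : D ≤ D.map φ) (n : ℕ) :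
    (orbitCore φ D (n + 1)).relIndex D = D.relIndex (D.map φ) ^ n := by
  induction n with
  | zero => rw [orbitCore_one, relIndex_self, pow_zero]
  | succ n ih => rw [relIndex_orbitCore_succ_succ, orbitImage_succ_of_le_map φ hD, ih, pow_succ']

/-- An orbit that starts in `D` can only leave `D` by leaving `W`. -/
theorem inf_orbitCore_le (φ : G →* G) {D W : Subgroup G} (hW : D.map φ ⊓ W ≤ D) (n : ℕ) :
    D ⊓ orbitCore φ W n ≤ orbitCore φ D n := by
  intro x hx
  rw [mem_inf, mem_orbitCore] at hx
  rw [mem_orbitCore]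
  intro k
  induction k with
  | zero => exact fun _ => hx.1
  | succ k ih =>
    intro hk
    refine hW ⟨?_, hx.2 _ hk⟩
    rw [Function.iterate_succ_apply']
    exact mem_map_of_mem φ (ih (by omega))

/-- The orbit images decrease, so these indices form a decreasing sequence of positive integers. -/
theorem exists_eventually_relIndex_orbitImage (φ : G →* G) (W : Subgroup G)
    (hfin : ∀ n, (orbitCore φ W n).relIndex W ≠ 0) :
    ∃ α ≠ 0, ∃ N, ∀ n ≥ N, W.relIndex (orbitImage φ W (n + 1)) = α := by
  have h0 : ∀ n, W.relIndex (orbitImage φ W (n + 1)) ≠ 0 := fun n h =>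
    hfin (n + 2) (by rw [relIndex_orbitCore_succ_succ, h, zero_mul])
  have hanti : Antitone fun n => W.relIndex (orbitImage φ W (n + 1)) :=
    antitone_nat_of_succ_le fun n =>
      relIndex_le_of_le_right (orbitImage_antitone φ W (Nat.le_succ _)) (h0 n)
  obtain ⟨N, hN⟩ := WellFoundedLT.antitone_chain_condition hanti
  exact ⟨_, h0 N, N, fun n hn => (hN n hn).symm⟩

/-! ### Products with `H` and the factorization of indices. -/

/-- `H` is normal, or it normalizes `A`. -/
def NormalOrNormalizes (H A : Subgroup G) : Prop := H.Normal ∨ H ≤ normalizer (A : Set G)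

namespace NormalOrNormalizes

variable {H A B : Subgroup G}

theorem exists_mul_eq (hA : NormalOrNormalizes H A) {h a : G} (hh : h ∈ H) (ha : a ∈ A) :
    ∃ a' ∈ A, ∃ h' ∈ H, h * a = a' * h' := by
  rcases hA with hN | hN
  · exact ⟨a, ha, a⁻¹ * h * a, by simpa using hN.conj_mem h hh a⁻¹, by group⟩
  · exact ⟨h * a * h⁻¹, (mem_normalizer_iff.1 (hN hh) a).1 ha, h, hh, by group⟩

/-- Since `HA ⊆ AH`, the set `AH` is already a subgroup. -/
theorem mem_sup (hA : NormalOrNormalizes H A) {x : G} :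
    x ∈ A ⊔ H ↔ ∃ a ∈ A, ∃ h ∈ H, x = a * h := by
  refine ⟨fun hx => ?_, ?_⟩
  · let S : Subgroup G :=
      { carrier := {x | ∃ a ∈ A, ∃ h ∈ H, x = a * h}
        one_mem' := ⟨1, one_mem _, 1, one_mem _, by simp⟩
        mul_mem' := by
          rintro _ _ ⟨a, ha, h, hh, rfl⟩ ⟨b, hb, k, hk, rfl⟩
          obtain ⟨c, hc, l, hl, he⟩ := hA.exists_mul_eq hh hb
          exact ⟨a * c, mul_mem ha hc, l * k, mul_mem hl hk, by
            rw [mul_assoc, ← mul_assoc h, he]; group⟩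
        inv_mem' := by
          rintro _ ⟨a, ha, h, hh, rfl⟩
          obtain ⟨c, hc, l, hl, he⟩ := hA.exists_mul_eq (inv_mem hh) (inv_mem ha)
          exact ⟨c, hc, l, hl, by rw [← he]; group⟩ }
    have h1 : A ≤ S := fun a ha => ⟨a, ha, 1, one_mem _, by simp⟩
    have h2 : H ≤ S := fun h hh => ⟨1, one_mem _, h, hh, by simp⟩
    exact sup_le h1 h2 hx
  · rintro ⟨a, ha, h, hh, rfl⟩
    exact mul_mem (le_sup_left (a := A) ha) (le_sup_right (a := A) hh)

theorem coe_sup (hA : NormalOrNormalizes H A) :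
    ((A ⊔ H : Subgroup G) : Set G) = (A : Set G) * (H : Set G) := by
  ext x
  simp only [SetLike.mem_coe, hA.mem_sup, Set.mem_mul, eq_comm]

theorem image_mk_sup (hA : NormalOrNormalizes H A) :
    (QuotientGroup.mk '' (A ⊔ H : Subgroup G) : Set (G ⧸ H)) = QuotientGroup.mk '' (A : Set G) := by
  refine Set.Subset.antisymm ?_ (Set.image_mono (le_sup_left (a := A)))
  rintro _ ⟨x, hx, rfl⟩
  obtain ⟨a, ha, h, hh, rfl⟩ := hA.mem_sup.1 hx
  exact ⟨a, ha, by simp [hh]⟩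

theorem inf (hA : NormalOrNormalizes H A) (hB : NormalOrNormalizes H B) :
    NormalOrNormalizes H (A ⊓ B) := by
  rcases hA with h | hA
  · exact Or.inl h
  rcases hB with h | hB
  · exact Or.inl h
  refine Or.inr fun h hh => mem_normalizer_iff.2 fun x => ?_
  rw [mem_inf, mem_inf, ← mem_normalizer_iff.1 (hA hh), ← mem_normalizer_iff.1 (hB hh)]

theorem iInf {ι : Type*} {A : ι → Subgroup G} (hA : ∀ i, NormalOrNormalizes H (A i)) :
    NormalOrNormalizes H (⨅ i, A i) := by
  by_cases h : H.Normal
  · exact Or.inl h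
  refine Or.inr fun h' hh => mem_normalizer_iff.2 fun x => ?_
  simp only [mem_iInf]
  exact forall_congr' fun i => mem_normalizer_iff.1 (((hA i).resolve_left h) hh) x

theorem map {φ : G →* G} (hA : NormalOrNormalizes H A) (hφ : H.map φ = H) :
    NormalOrNormalizes H (A.map φ) := by
  refine hA.imp id fun hA => ?_
  conv_lhs => rw [← hφ]
  exact (map_mono hA).trans (le_normalizer_map φ)

end NormalOrNormalizes

/-- Insert `AH ∩ B` between `A` and `B`. The cosets of `A` in `AH ∩ B` have representatives in `B ∩
H`, and those of `AH` in `BH` have representatives in `B`. -/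
theorem relIndex_eq_mul_of_le {H A B : Subgroup G} (hA : NormalOrNormalizes H A)
    (hB : NormalOrNormalizes H B) (hAB : A ≤ B) :
    A.relIndex B = A.relIndex (B ⊓ H) * (A ⊔ H).relIndex (B ⊔ H) := by
  have h1 : A.relIndex (B ⊓ H) = A.relIndex ((A ⊔ H) ⊓ B) := by
    refine relIndex_eq_of_forall_exists (le_inf (inf_le_right.trans le_sup_right) inf_le_left) ?_
    rintro x ⟨hx, hxB⟩
    obtain ⟨a, ha, h, hh, he⟩ := hA.mem_sup.1 ((A ⊔ H).inv_mem hx)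
    have hx' : x = h⁻¹ * a⁻¹ := by rw [← inv_inv x, he]; group
    refine ⟨h⁻¹, ⟨?_, H.inv_mem hh⟩, by simpa [hx'] using ha⟩
    have := mul_mem hxB (hAB ha)
    simpa [hx'] using this
  have h2 : (A ⊔ H).relIndex B = (A ⊔ H).relIndex (B ⊔ H) := by
    refine relIndex_eq_of_forall_exists le_sup_left fun x hx => ?_
    obtain ⟨b, hb, h, hh, rfl⟩ := hB.mem_sup.1 hx
    exact ⟨b, hb, by simpa using le_sup_right (a := A) hh⟩
  rw [h1, ← h2, relIndex_inf_mul_relIndex, inf_of_le_left le_sup_left]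

/-! ### Points with long backward orbits. -/

section backwardCore

/-- The subgroup of all points of `U` that have backward `φ`-orbits of all finite lengths in `U`. -/
def backwardCore (φ : G →* G) (U : Subgroup G) : Subgroup G :=
  ⨅ n, orbitImage φ U n ⊓ U

variable {φ : G →* G} {U : Subgroup G}

theorem backwardCore_le : backwardCore φ U ≤ U := (iInf_le _ 0).trans inf_le_right

theorem map_backwardCore_le (n : ℕ) : (backwardCore φ U).map φ ≤ orbitImage φ U n := by
  cases n with
  | zero => exact le_top
  | succ n => rw [orbitImage_succ]; exact map_mono (iInf_le _ n)

theorem map_backwardCore_inf_le : (backwardCore φ U).map φ ⊓ U ≤ backwardCore φ U :=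
  le_iInf fun n => inf_le_inf_right _ (map_backwardCore_le n)

end backwardCore

end Subgroup

/-! ### Growth rates of indices. -/

open Subgroup Dynamics ExpGrowth

/-- The exponential growth rate of the index in `W` of the subgroup of all `x` such that
`φ^[k] x ∈ W` for all `k < n`. -/
noncomputable def indexGrowth {G : Type*} [Group G] (φ : G →* G) (W : Subgroup G) : EReal :=
  expGrowthSup fun n => ((orbitCore φ W n).relIndex W : ENNReal)

section indexGrowth

variable {G : Type*} [Group G] {φ : G →* G} {W : Subgroup G}

theorem relIndex_orbitCore_add {α N : ℕ}
    (hN : ∀ n ≥ N, W.relIndex (orbitImage φ W (n + 1)) = α) (k : ℕ) :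
    (orbitCore φ W (N + 1 + k)).relIndex W = α ^ k * (orbitCore φ W (N + 1)).relIndex W := by
  induction k with
  | zero => simp
  | succ k ih =>
    have := relIndex_orbitCore_succ_succ φ W (N + k)
    rw [hN _ (by omega), show N + k + 1 = N + 1 + k by omega, ih] at this
    rw [show N + 1 + (k + 1) = N + k + 2 by omega, this]
    ring

theorem indexGrowth_le_log {α N : ℕ} (hα : α ≠ 0)
    (hN : ∀ n ≥ N, W.relIndex (orbitImage φ W (n + 1)) = α) :
    indexGrowth φ W ≤ ENNReal.log α := by
  rw [← expGrowthSup_pow]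
  refine expGrowthSup_le_of_eventually_le (b := ((orbitCore φ W (N + 1)).relIndex W : ENNReal))
    (ENNReal.natCast_ne_top _) (eventually_atTop.2 ⟨N + 1, fun n hn => ?_⟩)
  obtain ⟨k, rfl⟩ := Nat.exists_eq_add_of_le hn
  rw [relIndex_orbitCore_add hN]
  norm_cast
  rw [mul_comm]
  exact Nat.mul_le_mul_left _ (Nat.pow_le_pow_right (Nat.pos_of_ne_zero hα) (by omega))

theorem log_le_expGrowthInf {α N : ℕ} (hfin : ∀ n, (orbitCore φ W n).relIndex W ≠ 0)
    (hN : ∀ n ≥ N, W.relIndex (orbitImage φ W (n + 1)) = α) :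
    ENNReal.log α ≤ expGrowthInf fun n => ((orbitCore φ W n).relIndex W : ENNReal) := by
  rw [← expGrowthInf_pow]
  refine expGrowthInf_le_of_eventually_le (b := ((α ^ (N + 1) : ℕ) : ENNReal))
    (ENNReal.natCast_ne_top _) (eventually_atTop.2 ⟨N + 1, fun n hn => ?_⟩)
  obtain ⟨k, rfl⟩ := Nat.exists_eq_add_of_le hn
  rw [relIndex_orbitCore_add hN]
  norm_cast
  rw [pow_add]
  exact Nat.mul_le_mul_left _ (Nat.le_mul_of_pos_right _ (Nat.pos_of_ne_zero (hfin _)))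

/-- The indices are eventually geometric. The lower rate matters because upper rates alone are not
superadditive on products. -/
theorem indexGrowth_eq_expGrowthInf (hfin : ∀ n, (orbitCore φ W n).relIndex W ≠ 0) :
    indexGrowth φ W = expGrowthInf fun n => ((orbitCore φ W n).relIndex W : ENNReal) := by
  obtain ⟨α, hα, N, hN⟩ := exists_eventually_relIndex_orbitImage φ W hfin
  exact ((indexGrowth_le_log hα hN).trans (log_le_expGrowthInf hfin hN)).antisymm
    expGrowthInf_le_expGrowthSup

/-- Passing from `W'` to `W` costs only the constant factor `[W : W']`. -/
theorem indexGrowth_anti {W' : Subgroup G} (h : W' ≤ W) (hW' : W'.relIndex W ≠ 0)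
    (hfin : ∀ n, (orbitCore φ W' n).relIndex W' ≠ 0) : indexGrowth φ W ≤ indexGrowth φ W' := by
  refine expGrowthSup_le_of_eventually_le (b := (W'.relIndex W : ENNReal))
    (ENNReal.natCast_ne_top _) (eventually_atTop.2 ⟨1, fun n hn => ?_⟩)
  obtain ⟨k, rfl⟩ := Nat.exists_eq_add_of_le' hn
  have h1 := relIndex_mul_relIndex _ _ _ (orbitCore_succ_le φ W' k) h
  norm_cast
  rw [mul_comm, h1]
  exact relIndex_le_of_le_left (orbitCore_mono_left φ h _)
    (h1 ▸ mul_ne_zero (hfin _) hW')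

end indexGrowth

/-! ### Entropy as growth of subgroup indices. -/

/-- The relation between points of `X` that have representatives `x`, `y` in the group `G`
with `x⁻¹ * y ∈ W`. -/
def leftRelImage {G X : Type*} [Group G] (p : G → X) (W : Subgroup G) : SetRel X X :=
  Prod.map p p '' ((fun q : G × G => q.1⁻¹ * q.2) ⁻¹' (W : Set G))

/-- The map `T` of the uniform space `X` is the image under `p : G → X` of the endomorphism `φ`
of the group `G`, and the uniformity of `X` has a basis given by a family of subgroups `W` of `G`
which are unions of fibres of `p` and have compact image. -/
structure IsSubgroupModel {G X : Type*} [Group G] [UniformSpace X] (φ : G →* G) (T : X → X)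
    (p : G → X) (𝒲 : Subgroup G → Prop) : Prop where
  surjective : Function.Surjective p
  semiconj : Function.Semiconj p φ T
  hasBasis : (𝓤 X).HasBasis 𝒲 (leftRelImage p)
  mem_of_mem : ∀ W, 𝒲 W → ∀ x y, (p x, p y) ∈ leftRelImage p W → x⁻¹ * y ∈ W
  isCompact : ∀ W, 𝒲 W → IsCompact (p '' W)
  relIndex_ne_zero : ∀ W, 𝒲 W → ∀ n, (orbitCore φ W n).relIndex W ≠ 0

namespace IsSubgroupModel

variable {G X : Type*} [Group G] [UniformSpace X] {φ : G →* G} {T : X → X} {p : G → X}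
  {𝒲 : Subgroup G → Prop} {W : Subgroup G}

theorem mem_leftRelImage (h : IsSubgroupModel φ T p 𝒲) (hW : 𝒲 W) (x y : G) :
    (p x, p y) ∈ leftRelImage p W ↔ x⁻¹ * y ∈ W :=
  ⟨h.mem_of_mem W hW x y, fun hxy => ⟨(x, y), hxy, rfl⟩⟩

theorem mem_dynEntourage (h : IsSubgroupModel φ T p 𝒲) (hW : 𝒲 W) (n : ℕ) (x y : G) :
    (p x, p y) ∈ dynEntourage T (leftRelImage p W) n ↔ x⁻¹ * y ∈ orbitCore φ W n := by
  rw [Dynamics.mem_dynEntourage, mem_orbitCore]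
  refine forall₂_congr fun k _ => ?_
  rw [← (h.semiconj.iterate_right k).eq, ← (h.semiconj.iterate_right k).eq,
    h.mem_leftRelImage hW, iterate_map_mul, iterate_map_inv]

/-- Two points of `D` shadowed by the same centre differ by an element of `D ∩ C_n(W)`, hence lie in
one coset of `C`. -/
theorem relIndex_le_coverMincard (h : IsSubgroupModel φ T p 𝒲) (hW : 𝒲 W) {n : ℕ}
    {C D : Subgroup G} (hC : D ⊓ orbitCore φ W n ≤ C) :
    (C.relIndex D : ℕ∞) ≤ coverMincard T (p '' D) (leftRelImage p W) n := by
  classical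
  refine le_iInf₂ fun s hs => ?_
  have hex : ∀ e : s, ∃ x : D, (∃ y ∈ D, (p y, (e : X)) ∈ dynEntourage T (leftRelImage p W) n) →
      (p x, (e : X)) ∈ dynEntourage T (leftRelImage p W) n := by
    intro e
    by_cases he : ∃ y ∈ D, (p y, (e : X)) ∈ dynEntourage T (leftRelImage p W) n
    · obtain ⟨y, hy, hye⟩ := he
      exact ⟨⟨y, hy⟩, fun _ => hye⟩
    · exact ⟨1, fun h => absurd h he⟩
  choose f hf using hex
  have hsurj : Function.Surjective fun e => (QuotientGroup.mk (f e) : D ⧸ C.subgroupOf D) := by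
    intro q
    obtain ⟨x, rfl⟩ := QuotientGroup.mk_surjective q
    obtain ⟨e, he, hxe⟩ := hs (Set.mem_image_of_mem p x.2)
    have hfe := hf ⟨e, he⟩ ⟨x, x.2, hxe⟩
    obtain ⟨z, rfl⟩ := h.surjective e
    rw [h.mem_dynEntourage hW] at hfe hxe
    refine ⟨⟨p z, he⟩, QuotientGroup.eq.2 (mem_subgroupOf.2 (hC ⟨?_, ?_⟩))⟩
    · exact ((f ⟨p z, he⟩)⁻¹ * x).2
    · have := mul_mem hfe (inv_mem hxe)
      simpa [mul_assoc] using this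
  have := Nat.card_le_card_of_surjective _ hsurj
  rw [Nat.card_eq_fintype_card (α := s), Fintype.card_coe] at this
  exact_mod_cast this

/-- Finitely many translates of `W` cover `F`, independently of `n`, and each splits into `[W :
C_{n+1}(W)]` cosets. -/
theorem exists_coverMincard_le (h : IsSubgroupModel φ T p 𝒲) (hW : 𝒲 W) {F : Set X}
    (hF : IsCompact F) : ∃ b : ℕ, ∀ n,
      coverMincard T F (leftRelImage p W) (n + 1) ≤
        ((b * (orbitCore φ W (n + 1)).relIndex W : ℕ) : ℕ∞) := by
  classical
  obtain ⟨t, -, ht, hFt⟩ := totallyBounded_iff_subset.1 hF.totallyBounded _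
    (h.hasBasis.mem_of_mem hW)
  lift t to Finset X using ht
  choose g hg using h.surjective
  refine ⟨t.card, fun n => ?_⟩
  have : Finite (W ⧸ (orbitCore φ W (n + 1)).subgroupOf W) :=
    Nat.finite_of_card_ne_zero (h.relIndex_ne_zero W hW (n + 1))
  have := Fintype.ofFinite (W ⧸ (orbitCore φ W (n + 1)).subgroupOf W)
  let s : Finset X := (t ×ˢ (Finset.univ : Finset (W ⧸ (orbitCore φ W (n + 1)).subgroupOf W))).image
    fun q => p (g q.1 * (q.2.out : W))
  have hs : IsDynCoverOf T F (leftRelImage p W) (n + 1) s := by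
    intro x hx
    obtain ⟨y, hy, hxy⟩ := Set.mem_iUnion₂.1 (hFt hx)
    obtain ⟨z, rfl⟩ := h.surjective x
    have hzy : z⁻¹ * g y ∈ W := (h.mem_leftRelImage hW _ _).1 (by simpa [hg] using hxy)
    let q : W ⧸ (orbitCore φ W (n + 1)).subgroupOf W := QuotientGroup.mk (⟨_, hzy⟩⁻¹)
    refine ⟨p (g y * (q.out : W)), Finset.mem_coe.2 (Finset.mem_image.2 ⟨(y, q), by simpa using hy,
      rfl⟩), ?_⟩
    rw [h.mem_dynEntourage hW]
    have : (QuotientGroup.mk q.out : W ⧸ (orbitCore φ W (n + 1)).subgroupOf W) = q :=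
      QuotientGroup.out_eq' q
    have := mem_subgroupOf.1 (QuotientGroup.eq.1 this.symm)
    simpa [mul_assoc] using this
  refine hs.coverMincard_le_card.trans ?_
  have hc : s.card ≤ t.card * (orbitCore φ W (n + 1)).relIndex W := by
    refine Finset.card_image_le.trans ?_
    rw [Finset.card_product, Finset.card_univ, ← Nat.card_eq_fintype_card]
    rfl
  exact_mod_cast hc

theorem indexGrowth_le_hoodEntropy (h : IsSubgroupModel φ T p 𝒲) (hW : 𝒲 W) :
    indexGrowth φ W ≤ hoodEntropy T := by
  refine le_trans ?_ (le_iSup₂_of_le (p '' W) (h.isCompact W hW)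
    (coverEntropyEntourage_le_coverEntropy T _ (h.hasBasis.mem_of_mem hW)))
  refine expGrowthSup_monotone fun n => ?_
  have := h.relIndex_le_coverMincard hW (n := n) (D := W) inf_le_right
  simpa using ENat.toENNReal_mono this

theorem hoodEntropy_eq (h : IsSubgroupModel φ T p 𝒲) :
    hoodEntropy T = ⨆ (W : Subgroup G) (_ : 𝒲 W), indexGrowth φ W := by
  refine le_antisymm (iSup₂_le fun F hF => ?_) (iSup₂_le fun W hW => h.indexGrowth_le_hoodEntropy hW)
  rw [coverEntropy_eq_iSup_basis h.hasBasis]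
  refine iSup₂_mono fun W hW => ?_
  obtain ⟨b, hb⟩ := h.exists_coverMincard_le hW hF
  refine expGrowthSup_le_of_eventually_le (b := (b : ENNReal))
    (ENNReal.natCast_ne_top _) (eventually_atTop.2 ⟨1, fun n hn => ?_⟩)
  obtain ⟨k, rfl⟩ := Nat.exists_eq_add_of_le' hn
  exact_mod_cast ENat.toENNReal_mono (hb k)

/-- A subgroup `D` with `D ≤ φ(D)` contributes `log [φ(D) : D]` to the entropy, provided `D`
contains the intersection of `φ(D)` with a basic subgroup `W`. -/
theorem log_relIndex_le_hoodEntropy (h : IsSubgroupModel φ T p 𝒲) (hW : 𝒲 W) {D : Subgroup G}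
    (hD : D ≤ D.map φ) (hDc : IsCompact (p '' D)) (hDW : D.map φ ⊓ W ≤ D) :
    ENNReal.log (D.relIndex (D.map φ)) ≤ hoodEntropy T := by
  refine le_trans ?_ (le_iSup₂_of_le (p '' D) hDc
    (coverEntropyEntourage_le_coverEntropy T _ (h.hasBasis.mem_of_mem hW)))
  rw [← expGrowthSup_pow]
  -- At time `k + 1` the covering number is only bounded below by the `k`-th power of the index; the
  -- constant supplies the missing factor.
  refine expGrowthSup_le_of_eventually_le (b := (D.relIndex (D.map φ) : ENNReal))
    (ENNReal.natCast_ne_top _) (eventually_atTop.2 ⟨1, fun n hn => ?_⟩)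
  obtain ⟨k, rfl⟩ := Nat.exists_eq_add_of_le' hn
  have := h.relIndex_le_coverMincard hW (inf_orbitCore_le φ hDW (k + 1))
  rw [relIndex_orbitCore_of_le_map φ hD] at this
  rw [pow_succ']
  refine mul_le_mul_right ?_ _
  exact_mod_cast ENat.toENNReal_mono this

end IsSubgroupModel

/-! ### Compactness of the backward core, and compact open subgroups. -/

section TopologicalSpace

variable {G : Type*} [Group G] [TopologicalSpace G] {φ : G →* G}

theorem Subgroup.isOpen_orbitCore (hφ : Continuous φ) {W : Subgroup G}
    (hW : IsOpen (W : Set G)) (n : ℕ) : IsOpen (orbitCore φ W n : Set G) := by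
  induction n with
  | zero => exact isOpen_univ
  | succ n ih => exact hW.inter (ih.preimage hφ)

theorem Subgroup.isCompact_orbitImage_inf [T2Space G] (hφ : Continuous φ)
    {U : Subgroup G} (hU : IsCompact (U : Set G)) (n : ℕ) :
    IsCompact ((orbitImage φ U n ⊓ U : Subgroup G) : Set G) := by
  induction n with
  | zero => simpa [orbitImage, orbitCore] using hU
  | succ n ih =>
    rw [orbitImage_succ]
    exact (ih.image hφ).inter hU

theorem Subgroup.isCompact_backwardCore [T2Space G] (hφ : Continuous φ)
    {U : Subgroup G} (hU : IsCompact (U : Set G)) : IsCompact (backwardCore φ U : Set G) := by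
  rw [backwardCore, coe_iInf]
  exact (isCompact_orbitImage_inf hφ hU 0).of_isClosed_subset
    (isClosed_iInter fun n => (isCompact_orbitImage_inf hφ hU n).isClosed) (Set.iInter_subset _ 0)

/-- Cantor's intersection theorem for the compact sets `(φ^n(C_n(U)) ∩ U) ∩ φ⁻¹(S)`, which decrease
with `n`. -/
theorem Subgroup.exists_mem_backwardCore [T2Space G] (hφ : Continuous φ)
    {U : Subgroup G} (hU : IsCompact (U : Set G)) {S : Set G} (hS : IsClosed S)
    (h : ∀ n, ∃ y ∈ orbitImage φ U n ⊓ U, φ y ∈ S) : ∃ y ∈ backwardCore φ U, φ y ∈ S := by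
  have hc := isCompact_orbitImage_inf hφ hU
  obtain ⟨y, hy⟩ := IsCompact.nonempty_iInter_of_sequence_nonempty_isCompact_isClosed
    (fun n => ((orbitImage φ U n ⊓ U : Subgroup G) : Set G) ∩ φ ⁻¹' S)
    (fun n => Set.inter_subset_inter_left _
      (SetLike.coe_subset_coe.2 (inf_le_inf_right _ (orbitImage_antitone φ U n.le_succ))))
    h ((hc 0).inter_right (hS.preimage hφ)) (fun n => (hc n).isClosed.inter (hS.preimage hφ))
  rw [Set.mem_iInter] at hy
  exact ⟨y, mem_iInf.2 fun n => (hy n).1, (hy 0).2⟩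

theorem Subgroup.backwardCore_le_map [T2Space G] (hφ : Continuous φ)
    {U : Subgroup G} (hU : IsCompact (U : Set G)) : backwardCore φ U ≤ (backwardCore φ U).map φ := by
  intro x hx
  refine exists_mem_backwardCore hφ hU (isClosed_singleton (x := x)) fun n => ?_
  have := (mem_iInf.1 hx (n + 1)).1
  rw [orbitImage_succ] at this
  exact this

/-- The compact open subgroups that are normalized by `H`, or all compact open subgroups
if `H` is normal. -/
structure IsAdapted (H U : Subgroup G) : Prop where
  isOpen : IsOpen (U : Set G)
  isCompact : IsCompact (U : Set G)
  normalOrNormalizes : NormalOrNormalizes H U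

theorem IsAdapted.inf [T2Space G] {H U V : Subgroup G} (hU : IsAdapted H U) (hV : IsAdapted H V) :
    IsAdapted H (U ⊓ V) :=
  ⟨hU.isOpen.inter hV.isOpen, hU.isCompact.inter hV.isCompact,
    hU.normalOrNormalizes.inf hV.normalOrNormalizes⟩

end TopologicalSpace

section TopologicalGroup

variable {G : Type*} [Group G] [TopologicalSpace G] [IsTopologicalGroup G]

theorem Subgroup.relIndex_ne_zero_of_isOpen_of_isCompact {A K : Subgroup G}
    (hA : IsOpen (A : Set G)) (hK : IsCompact (K : Set G)) : A.relIndex K ≠ 0 := by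
  have : CompactSpace K := isCompact_iff_compactSpace.1 hK
  have : Finite (K ⧸ A.subgroupOf K) :=
    quotient_finite_of_isOpen _ (hA.preimage continuous_subtype_val)
  exact Nat.card_pos.ne'

/-- A locally compact totally disconnected group has a basis of compact open subgroups. -/
theorem exists_isOpen_isCompact_subgroup_subset [T2Space G] [LocallyCompactSpace G]
    [TotallyDisconnectedSpace G] {O : Set G} (hO : O ∈ 𝓝 (1 : G)) :
    ∃ U : Subgroup G, IsOpen (U : Set G) ∧ IsCompact (U : Set G) ∧ (U : Set G) ⊆ O := by
  obtain ⟨K, hK, hKO, hKc⟩ := local_compact_nhds hO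
  obtain ⟨W, hW, h1W, hWK⟩ :=
    (loc_compact_Haus_tot_disc_of_zero_dim (H := G)).mem_nhds_iff.1 hK
  have hWc : IsCompact W := hKc.of_isClosed_subset hW.isClosed hWK
  have key : ∀ᶠ x in 𝓝 (1 : G), ∀ w ∈ W, x * w ∈ W := by
    refine hWc.eventually_forall_of_forall_eventually fun w hw => ?_
    have hcont : Continuous fun p : G × G => p.1 * p.2 := continuous_mul
    exact hcont.continuousAt.eventually (hW.isOpen.mem_nhds (by simpa using hw))
  have key' : ∀ᶠ x in 𝓝 (1 : G), ∀ w ∈ W, x⁻¹ * w ∈ W :=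
    (continuous_inv.tendsto' (1 : G) 1 inv_one).eventually key
  -- The subgroup is the stabilizer of the compact open set `W` under left translation; it lies in
  -- `W` because `1 ∈ W`.
  have hmem : ((MulAction.stabilizer G W : Subgroup G) : Set G) ∈ 𝓝 (1 : G) := by
    filter_upwards [key, key'] with x hx hx'
    refine MulAction.mem_stabilizer_iff.2 (Set.Subset.antisymm ?_ fun w hw => ?_)
    · rintro _ ⟨w, hw, rfl⟩
      exact hx w hw
    · exact ⟨x⁻¹ * w, hx' w hw, by simp⟩
  have hsub : ((MulAction.stabilizer G W : Subgroup G) : Set G) ⊆ W := fun x hx => by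
    rw [← MulAction.mem_stabilizer_iff.1 hx]
    exact ⟨1, h1W, by simp⟩
  have hopen := isOpen_of_mem_nhds _ hmem
  exact ⟨_, hopen, hWc.of_isClosed_subset (isClosed_of_isOpen _ hopen) hsub,
    hsub.trans (hWK.trans hKO)⟩

/-- For compact `H`, intersect all `H`-conjugates of a compact open subgroup; compactness of `H`
keeps the intersection a neighbourhood of `1`. -/
theorem exists_isAdapted_subset [T2Space G] [LocallyCompactSpace G]
    [TotallyDisconnectedSpace G] {H : Subgroup G} (hH : H.Normal ∨ IsCompact (H : Set G))
    {O : Set G} (hO : O ∈ 𝓝 (1 : G)) : ∃ U : Subgroup G, IsAdapted H U ∧ (U : Set G) ⊆ O := by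
  obtain ⟨U, hUo, hUc, hUO⟩ := exists_isOpen_isCompact_subgroup_subset hO
  rcases hH with hN | hC
  · exact ⟨U, ⟨hUo, hUc, Or.inl hN⟩, hUO⟩
  have key : ∀ᶠ l in 𝓝 (1 : G), ∀ h ∈ (H : Set G), h * l * h⁻¹ ∈ U := by
    refine hC.eventually_forall_of_forall_eventually fun h _ => ?_
    have hcont : Continuous fun p : G × G => p.2 * p.1 * p.2⁻¹ := by fun_prop
    exact hcont.continuousAt.eventually (hUo.mem_nhds (by simp))
  let V : Subgroup G := ⨅ h : H, U.comap (MulAut.conj (h : G)).toMonoidHom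
  have hV : ∀ x, x ∈ V ↔ ∀ h ∈ H, h * x * h⁻¹ ∈ U := fun x => by
    simp [V]
  have hVU : V ≤ U := fun x hx => by simpa using (hV x).1 hx 1 (one_mem H)
  have hVo : IsOpen (V : Set G) := by
    refine isOpen_of_mem_nhds V (g := 1) (key.mono fun x hx => (hV x).2 hx)
  refine ⟨V, ⟨hVo, hUc.of_isClosed_subset (isClosed_of_isOpen _ hVo) hVU, Or.inr ?_⟩,
    Set.Subset.trans hVU hUO⟩
  intro h hh
  refine mem_normalizer_iff.2 fun x => ?_
  rw [hV, hV]
  refine ⟨fun hx k hk => ?_, fun hx k hk => ?_⟩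
  · simpa [mul_assoc] using hx (k * h) (mul_mem hk hh)
  · simpa [mul_assoc] using hx (k * h⁻¹) (mul_mem hk (inv_mem hh))

section backwardCore

variable {φ : G →* G} {U : Subgroup G}

/-- Since `φ(A) ∩ U = A`, the index counts the cosets of `U` met by `φ(A)`. Every late orbit image
meets the same `α` cosets, and compactness passes this to `φ(A)`. -/
theorem Subgroup.relIndex_map_backwardCore [T2Space G] (hφ : Continuous φ)
    (hU : IsCompact (U : Set G)) {α N : ℕ} (hα : α ≠ 0)
    (hN : ∀ n ≥ N, U.relIndex (orbitImage φ U (n + 1)) = α) :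
    (backwardCore φ U).relIndex ((backwardCore φ U).map φ) = α := by
  have h1 : (backwardCore φ U).map φ ⊓ U = backwardCore φ U :=
    map_backwardCore_inf_le.antisymm (le_inf (backwardCore_le_map hφ hU) backwardCore_le)
  have h2 := inf_relIndex_left ((backwardCore φ U).map φ) U
  rw [h1] at h2
  rw [h2, ← hN N le_rfl]
  refine relIndex_eq_of_forall_exists (map_backwardCore_le _) fun x hx => ?_
  have hcl : IsClosed {z : G | x⁻¹ * z ∈ (U : Set G)} :=
    hU.isClosed.preimage (continuous_const_mul x⁻¹)
  suffices h : ∀ n, ∃ y ∈ orbitImage φ U n ⊓ U, x⁻¹ * φ y ∈ (U : Set G) by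
    obtain ⟨y, hy, hxy⟩ := exists_mem_backwardCore hφ hU hcl h
    exact ⟨φ y, mem_map_of_mem φ hy, hxy⟩
  intro n
  have hle : orbitImage φ U (max n N + 1) ≤ orbitImage φ U (N + 1) :=
    orbitImage_antitone φ U (by omega)
  obtain ⟨z, hz, hxz⟩ := forall_exists_of_relIndex_eq hle (by rwa [hN N le_rfl])
    ((hN _ (le_max_right n N)).trans (hN N le_rfl).symm) x hx
  rw [orbitImage_succ] at hz
  obtain ⟨y, hy, rfl⟩ := hz
  exact ⟨y, ⟨orbitImage_antitone φ U (le_max_left n N) hy.1, hy.2⟩, hxz⟩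

end backwardCore

/-- A closed subgroup of finite index is open. -/
theorem Subgroup.exists_nhds_inter_subset {D E : Subgroup G} (hD : IsClosed (D : Set G))
    (h0 : D.relIndex E ≠ 0) : ∃ O ∈ 𝓝 (1 : G), ∀ x ∈ O, x ∈ E → x ∈ D := by
  have : (D.subgroupOf E).FiniteIndex := ⟨h0⟩
  have hopen : IsOpen (D.subgroupOf E : Set E) :=
    isOpen_of_isClosed_of_finiteIndex _ (hD.preimage continuous_subtype_val)
  have := hopen.mem_nhds (one_mem (D.subgroupOf E))
  rw [nhds_subtype_eq_comap] at this
  obtain ⟨O, hO, hOD⟩ := this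
  exact ⟨O, hO, fun x hx hxE => hOD (a := ⟨x, hxE⟩) hx⟩

end TopologicalGroup

section Group

variable {G : Type*} [Group G]

theorem leftRelImage_id (W : Subgroup G) :
    leftRelImage id W = (fun q : G × G => q.1⁻¹ * q.2) ⁻¹' (W : Set G) := by
  simp [leftRelImage]

/-- The restriction of `φ` to `H`, as an endomorphism. -/
def restrictHom (φ : G →* G) (H : Subgroup G) (hφ : H.map φ ≤ H) : H →* H :=
  (φ.comp H.subtype).codRestrict H fun x => hφ (mem_map_of_mem φ x.2)

theorem orbitCore_subgroupOf (φ : G →* G) {H : Subgroup G}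
    (hφ : H.map φ ≤ H) (U : Subgroup G) (n : ℕ) :
    orbitCore (restrictHom φ H hφ) (U.subgroupOf H) n = (orbitCore φ U n).subgroupOf H := by
  induction n with
  | zero => rfl
  | succ n ih =>
    rw [orbitCore, ih]
    rfl

theorem map_subtype_map_restrictHom (φ : G →* G) {H : Subgroup G}
    (hφ : H.map φ ≤ H) (A : Subgroup G) :
    ((A.subgroupOf H).map (restrictHom φ H hφ)).map H.subtype = (A ⊓ H).map φ := by
  rw [← subgroupOf_map_subtype, Subgroup.map_map, Subgroup.map_map]
  rfl

theorem relIndex_sup_eq {H U C : Subgroup G} (hU : NormalOrNormalizes H U)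
    (hC : H ≤ C) : C.relIndex (U ⊔ H) = C.relIndex U := by
  refine (relIndex_eq_of_forall_exists le_sup_left fun x hx => ?_).symm
  obtain ⟨b, hb, h, hh, rfl⟩ := hU.mem_sup.1 hx
  exact ⟨b, hb, by simpa using hC hh⟩

end Group

/-! ### The subgroup models of `G`, `H` and `G ⧸ H`. -/

section AdditionTheorem

variable {G : Type*} [Group G] [TopologicalSpace G] [IsTopologicalGroup G]
  [T2Space G] [LocallyCompactSpace G] [TotallyDisconnectedSpace G]

theorem hasBasis_nhds_one_isAdapted {H : Subgroup G} (hH : H.Normal ∨ IsCompact (H : Set G)) :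
    (𝓝 (1 : G)).HasBasis (IsAdapted H) (fun U => (U : Set G)) := by
  refine ⟨fun O => ⟨fun hO => exists_isAdapted_subset hH hO, ?_⟩⟩
  rintro ⟨U, hU, hUO⟩
  exact mem_of_superset (hU.isOpen.mem_nhds (one_mem U)) hUO

theorem isSubgroupModel_group {φ : G →* G} (hφ : Continuous φ) {H : Subgroup G}
    (hH : H.Normal ∨ IsCompact (H : Set G)) :
    @IsSubgroupModel G G _ (IsTopologicalGroup.leftUniformSpace G) φ φ id (IsAdapted H) := by
  let _ : UniformSpace G := IsTopologicalGroup.leftUniformSpace G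
  refine ⟨Function.surjective_id, fun _ => rfl, ?_, fun W _ x y => ?_, fun W hW => ?_,
    fun W hW n => relIndex_ne_zero_of_isOpen_of_isCompact (isOpen_orbitCore hφ hW.isOpen n)
      hW.isCompact⟩
  · simp only [funext leftRelImage_id]
    exact (hasBasis_nhds_one_isAdapted hH).comap _
  · rw [leftRelImage_id]
    exact id
  · simpa using hW.isCompact

theorem isSubgroupModel_subgroup {φ : G →* G} (hφ : Continuous φ) {H : Subgroup G}
    (hclosed : IsClosed (H : Set G)) (hmap : H.map φ ≤ H)
    (hH : H.Normal ∨ IsCompact (H : Set G)) :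
    @IsSubgroupModel H H _ (IsTopologicalGroup.leftUniformSpace H) (restrictHom φ H hmap)
      (restrictMap φ H hmap) id (fun V => ∃ U, IsAdapted H U ∧ U.subgroupOf H = V) := by
  let _ : UniformSpace H := IsTopologicalGroup.leftUniformSpace H
  have hcont : Continuous (restrictHom φ H hmap) :=
    (hφ.comp continuous_subtype_val).subtype_mk _
  have hcpt : ∀ U : Subgroup G, IsCompact (U : Set G) → IsCompact (U.subgroupOf H : Set H) :=
    fun U hU => hclosed.isClosedEmbedding_subtypeVal.isCompact_preimage hU
  refine ⟨Function.surjective_id, fun _ => rfl, ?_, fun W _ x y => ?_, ?_, ?_⟩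
  · have hb : (𝓝 (1 : H)).HasBasis (fun V => ∃ U, IsAdapted H U ∧ U.subgroupOf H = V)
        (fun V : Subgroup H => (V : Set H)) := by
      rw [nhds_subtype_eq_comap]
      refine ((hasBasis_nhds_one_isAdapted hH).comap _).to_hasBasis
        (fun U hU => ⟨_, ⟨U, hU, rfl⟩, Set.Subset.rfl⟩) ?_
      rintro _ ⟨U, hU, rfl⟩
      exact ⟨U, hU, Set.Subset.rfl⟩
    simp only [funext leftRelImage_id]
    exact hb.comap _
  · rw [leftRelImage_id]
    exact id
  · rintro _ ⟨U, hU, rfl⟩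
    simpa using hcpt U hU.isCompact
  · rintro _ ⟨U, hU, rfl⟩ n
    exact relIndex_ne_zero_of_isOpen_of_isCompact
      (isOpen_orbitCore hcont (hU.isOpen.preimage continuous_subtype_val) n) (hcpt U hU.isCompact)

theorem isSubgroupModel_quotient {φ : G →* G} (hφ : Continuous φ) {H : Subgroup G}
    (hmap : H.map φ ≤ H) (hH : H.Normal ∨ IsCompact (H : Set G)) :
    @IsSubgroupModel G (G ⧸ H) _ (quotientLeftUniformSpace H hH) φ
      (quotientMap φ H hmap) QuotientGroup.mk (fun W => ∃ U, IsAdapted H U ∧ U ⊔ H = W) := by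
  let _ : UniformSpace (G ⧸ H) := quotientLeftUniformSpace H hH
  -- Enlarging `U` to `UH` changes no entourage of `G ⧸ H`, because the factor in `H` can be
  -- absorbed in the second representative; but it makes membership independent of representatives.
  have hrel : ∀ U, IsAdapted H U → leftRelImage (QuotientGroup.mk : G → G ⧸ H) (U ⊔ H) =
      Prod.map QuotientGroup.mk QuotientGroup.mk ''
        ((fun q : G × G => q.1⁻¹ * q.2) ⁻¹' (U : Set G)) := by
    intro U hU
    refine Set.Subset.antisymm ?_ (Set.image_mono (Set.preimage_mono (le_sup_left (a := U))))
    rintro _ ⟨⟨x, y⟩, hxy, rfl⟩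
    obtain ⟨u, hu, h, hh, he⟩ := hU.normalOrNormalizes.mem_sup.1 hxy
    refine ⟨(x, y * h⁻¹), ?_, ?_⟩
    · have : x⁻¹ * (y * h⁻¹) = u := by
        rw [← mul_assoc, mul_inv_eq_iff_eq_mul]
        exact he
      simpa [this] using hu
    · simp [hh]
  refine ⟨QuotientGroup.mk_surjective, fun _ => rfl, ?_, ?_, ?_, ?_⟩
  · have hb : (𝓤 (G ⧸ H)).HasBasis (IsAdapted H) fun U =>
        Prod.map QuotientGroup.mk QuotientGroup.mk ''
        ((fun q : G × G => q.1⁻¹ * q.2) ⁻¹' (U : Set G)) :=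
      ((hasBasis_nhds_one_isAdapted hH).comap _).map _
    refine hb.to_hasBasis (fun U hU => ⟨_, ⟨U, hU, rfl⟩, (hrel U hU).subset⟩) ?_
    rintro _ ⟨U, hU, rfl⟩
    exact ⟨U, hU, (hrel U hU).symm.subset⟩
  · rintro _ ⟨U, hU, rfl⟩ x y ⟨⟨x', y'⟩, hxy, he⟩
    simp only [Prod.map_apply, Prod.mk.injEq, QuotientGroup.eq] at he
    have h1 := le_sup_right (a := U) he.1
    have h2 := le_sup_right (a := U) he.2
    have := mul_mem (mul_mem (inv_mem h1) hxy) h2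
    simpa [mul_assoc] using this
  · rintro _ ⟨U, hU, rfl⟩
    rw [hU.normalOrNormalizes.image_mk_sup]
    exact hU.isCompact.image continuous_quot_mk
  · rintro _ ⟨U, hU, rfl⟩ n
    rw [relIndex_sup_eq hU.normalOrNormalizes (le_orbitCore φ le_sup_right hmap n)]
    exact relIndex_ne_zero_of_isOpen_of_isCompact
      (isOpen_orbitCore hφ (isOpen_mono le_sup_left hU.isOpen) n) hU.isCompact

end AdditionTheorem

/-! ### Index inequalities along `H`. -/

section Inequalities

variable {G : Type*} [Group G] {φ : G →* G} {H U : Subgroup G}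

/-- Insert `C_n(UH) ∩ U` between `C_n(U)` and `U`. It contains `U ∩ H`, since `H ≤ C_n(UH)`. -/
theorem relIndex_orbitCore_mul_le (hmap : H.map φ ≤ H) (hU : NormalOrNormalizes H U) {n : ℕ}
    (hfin : (orbitCore φ U n).relIndex U ≠ 0) :
    (orbitCore (restrictHom φ H hmap) (U.subgroupOf H) n).relIndex (U.subgroupOf H) *
      (orbitCore φ (U ⊔ H) n).relIndex (U ⊔ H) ≤ (orbitCore φ U n).relIndex U := by
  have hH : H ≤ orbitCore φ (U ⊔ H) n := le_orbitCore φ le_sup_right hmap n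
  have h1 := relIndex_inf_mul_relIndex (orbitCore φ U n) (orbitCore φ (U ⊔ H) n) U
  rw [inf_of_le_left (orbitCore_mono_left φ le_sup_left n)] at h1
  rw [orbitCore_subgroupOf, relIndex_sup_eq hU hH, ← h1, subgroupOf, relIndex_comap,
    subgroupOf_map_subtype]
  refine Nat.mul_le_mul_right _ (relIndex_le_of_le_right
    (le_inf (inf_le_right.trans hH) inf_le_left) fun h0 => hfin ?_)
  rw [← h1, h0, zero_mul]

theorem indexGrowth_add_le (hmap : H.map φ ≤ H) (hU : NormalOrNormalizes H U)
    (hfin : ∀ n, (orbitCore φ U n).relIndex U ≠ 0)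
    (hfin' : ∀ n, (orbitCore φ (U ⊔ H) n).relIndex (U ⊔ H) ≠ 0) :
    indexGrowth (restrictHom φ H hmap) (U.subgroupOf H) + indexGrowth φ (U ⊔ H) ≤
      indexGrowth φ U := by
  rw [indexGrowth_eq_expGrowthInf hfin']
  refine le_expGrowthSup_mul.trans (expGrowthSup_monotone fun n => ?_)
  rw [Pi.mul_apply]
  exact_mod_cast relIndex_orbitCore_mul_le hmap hU (hfin n)

/-- The two hypotheses together say `φ⁻¹(H) = H`. -/
theorem map_inf_of_ker_le (hstable : H.map φ = H) (hker : φ.ker ≤ H) (A : Subgroup G) :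
    (A ⊓ H).map φ = A.map φ ⊓ H := by
  have hcomap : H.comap φ = H := by
    conv_lhs => rw [← hstable]
    rw [comap_map_eq, sup_of_le_left hker]
  conv_lhs => rw [← hcomap]
  exact map_inf_comap φ A H

end Inequalities

/-! ### The two inequalities of the addition theorem. -/

section AdditionTheorem

variable {G : Type*} [Group G] [TopologicalSpace G] [IsTopologicalGroup G] [T2Space G]
  [LocallyCompactSpace G] [TotallyDisconnectedSpace G] {φ : G →* G} {H : Subgroup G}

theorem hoodEntropy_add_le (hφ : Continuous φ) (hclosed : IsClosed (H : Set G))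
    (hmap : H.map φ ≤ H) (hH : H.Normal ∨ IsCompact (H : Set G)) :
    @hoodEntropy H (IsTopologicalGroup.leftUniformSpace H) (restrictMap φ H hmap) +
        @hoodEntropy (G ⧸ H) (quotientLeftUniformSpace H hH) (quotientMap φ H hmap) ≤
      @hoodEntropy G (IsTopologicalGroup.leftUniformSpace G) φ := by
  let _ : UniformSpace G := IsTopologicalGroup.leftUniformSpace G
  let _ : UniformSpace H := IsTopologicalGroup.leftUniformSpace H
  let _ : UniformSpace (G ⧸ H) := quotientLeftUniformSpace H hH
  have mG := isSubgroupModel_group hφ hH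
  have mH := isSubgroupModel_subgroup hφ hclosed hmap hH
  have mQ := isSubgroupModel_quotient hφ hmap hH
  rw [mH.hoodEntropy_eq, mQ.hoodEntropy_eq]
  -- The two suprema may be approached along different subgroups `U₁`, `U₂`; the growth rates only
  -- increase on passing to `U₁ ⊓ U₂`.
  refine EReal.add_le_of_forall_lt fun a ha b hb => ?_
  simp only [lt_iSup_iff, exists_prop] at ha hb
  obtain ⟨_, ⟨U₁, hU₁, rfl⟩, ha⟩ := ha
  obtain ⟨_, ⟨U₂, hU₂, rfl⟩, hb⟩ := hb
  have hU := hU₁.inf hU₂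
  have h1 : indexGrowth (restrictHom φ H hmap) (U₁.subgroupOf H) ≤
      indexGrowth (restrictHom φ H hmap) ((U₁ ⊓ U₂).subgroupOf H) := by
    refine indexGrowth_anti (comap_mono inf_le_left) ?_ (mH.relIndex_ne_zero _ ⟨_, hU, rfl⟩)
    rw [subgroupOf, relIndex_comap, subgroupOf_map_subtype]
    exact relIndex_ne_zero_of_isOpen_of_isCompact hU.isOpen (hU₁.isCompact.inter_right hclosed)
  have h2 : indexGrowth φ (U₂ ⊔ H) ≤ indexGrowth φ (U₁ ⊓ U₂ ⊔ H) := by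
    refine indexGrowth_anti (sup_le_sup_right inf_le_right _) ?_
      (mQ.relIndex_ne_zero _ ⟨_, hU, rfl⟩)
    rw [relIndex_sup_eq hU₂.normalOrNormalizes le_sup_right]
    exact relIndex_ne_zero_of_isOpen_of_isCompact (isOpen_mono le_sup_left hU.isOpen)
      hU₂.isCompact
  calc a + b ≤ _ := add_le_add (ha.le.trans h1) (hb.le.trans h2)
    _ ≤ indexGrowth φ (U₁ ⊓ U₂) := indexGrowth_add_le hmap hU.normalOrNormalizes
        (mG.relIndex_ne_zero _ hU) (mQ.relIndex_ne_zero _ ⟨_, hU, rfl⟩)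
    _ ≤ _ := mG.indexGrowth_le_hoodEntropy hU

theorem log_relIndex_backwardCore_inf_le (hφ : Continuous φ) (hclosed : IsClosed (H : Set G))
    (hstable : H.map φ = H) (hker : φ.ker ≤ H) (hH : H.Normal ∨ IsCompact (H : Set G))
    {U : Subgroup G} (hU : IsAdapted H U) :
    ENNReal.log ((backwardCore φ U).relIndex ((backwardCore φ U).map φ ⊓ H)) ≤
      @hoodEntropy H (IsTopologicalGroup.leftUniformSpace H) (restrictMap φ H hstable.le) := by
  let _ : UniformSpace H := IsTopologicalGroup.leftUniformSpace H
  have mH := isSubgroupModel_subgroup hφ hclosed hstable.le hH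
  have hA : ((backwardCore φ U).subgroupOf H).map (restrictHom φ H hstable.le) =
      ((backwardCore φ U).map φ).subgroupOf H := by
    apply Subgroup.map_injective H.subtype_injective
    rw [map_subtype_map_restrictHom, subgroupOf_map_subtype, map_inf_of_ker_le hstable hker]
  have h := mH.log_relIndex_le_hoodEntropy ⟨U, hU, rfl⟩ (D := (backwardCore φ U).subgroupOf H)
  rw [hA] at h
  have hidx : ((backwardCore φ U).subgroupOf H).relIndex (((backwardCore φ U).map φ).subgroupOf H) =
      (backwardCore φ U).relIndex ((backwardCore φ U).map φ ⊓ H) := by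
    rw [subgroupOf, relIndex_comap, subgroupOf_map_subtype]
  rw [← hidx]
  refine h (comap_mono (backwardCore_le_map hφ hU.isCompact)) ?_
    (comap_mono map_backwardCore_inf_le)
  rw [Set.image_id]
  exact hclosed.isClosedEmbedding_subtypeVal.isCompact_preimage
    (isCompact_backwardCore hφ hU.isCompact)

/-- Take `D = AH`, closed as a compact set times a closed one. Having finite index in `φ(D)`, it is
open there, so some adapted `V` satisfies `φ(D) ∩ VH ≤ D`. -/
theorem log_relIndex_backwardCore_sup_le (hφ : Continuous φ) (hclosed : IsClosed (H : Set G))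
    (hstable : H.map φ = H) (hH : H.Normal ∨ IsCompact (H : Set G))
    {U : Subgroup G} (hU : IsAdapted H U) (hA : NormalOrNormalizes H (backwardCore φ U))
    (h0 : (backwardCore φ U ⊔ H).relIndex ((backwardCore φ U).map φ ⊔ H) ≠ 0) :
    ENNReal.log ((backwardCore φ U ⊔ H).relIndex ((backwardCore φ U).map φ ⊔ H)) ≤
      @hoodEntropy (G ⧸ H) (quotientLeftUniformSpace H hH) (quotientMap φ H hstable.le) := by
  let _ : UniformSpace (G ⧸ H) := quotientLeftUniformSpace H hH
  have mQ := isSubgroupModel_quotient hφ hstable.le hH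
  have hmap : (backwardCore φ U ⊔ H).map φ = (backwardCore φ U).map φ ⊔ H := by
    rw [Subgroup.map_sup, hstable]
  have hAc := isCompact_backwardCore hφ hU.isCompact
  have hDc : IsClosed ((backwardCore φ U ⊔ H : Subgroup G) : Set G) := by
    rw [hA.coe_sup]
    exact hclosed.mul_left_of_isCompact hAc
  obtain ⟨O, hO, hOD⟩ := exists_nhds_inter_subset hDc h0
  obtain ⟨V, hV, hVO⟩ := exists_isAdapted_subset hH hO
  have h := mQ.log_relIndex_le_hoodEntropy ⟨V, hV, rfl⟩ (D := backwardCore φ U ⊔ H)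
  rw [hmap] at h
  refine h (sup_le_sup_right (backwardCore_le_map hφ hU.isCompact) _) ?_ ?_
  · rw [hA.image_mk_sup]
    exact hAc.image continuous_quot_mk
  · rintro x ⟨hx, hxV⟩
    obtain ⟨v, hv, k, hk, rfl⟩ := hV.normalOrNormalizes.mem_sup.1 hxV
    refine mul_mem (hOD v (hVO hv) ?_) (le_sup_right (a := backwardCore φ U) hk)
    have := mul_mem hx (Subgroup.inv_mem _ (le_sup_right (a := (backwardCore φ U).map φ) hk))
    simpa using this

theorem hoodEntropy_le_add (hφ : Continuous φ) (hclosed : IsClosed (H : Set G))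
    (hstable : H.map φ = H) (hker : φ.ker ≤ H) (hH : H.Normal ∨ IsCompact (H : Set G)) :
    @hoodEntropy G (IsTopologicalGroup.leftUniformSpace G) φ ≤
      @hoodEntropy H (IsTopologicalGroup.leftUniformSpace H) (restrictMap φ H hstable.le) +
      @hoodEntropy (G ⧸ H) (quotientLeftUniformSpace H hH) (quotientMap φ H hstable.le) := by
  let _ : UniformSpace G := IsTopologicalGroup.leftUniformSpace G
  have mG := isSubgroupModel_group hφ hH
  rw [mG.hoodEntropy_eq]
  refine iSup₂_le fun U hU => ?_
  obtain ⟨α, hα, N, hN⟩ := exists_eventually_relIndex_orbitImage φ U (mG.relIndex_ne_zero U hU)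
  refine (indexGrowth_le_log hα hN).trans ?_
  have hA : NormalOrNormalizes H (backwardCore φ U) := by
    have : ∀ n, NormalOrNormalizes H (orbitImage φ U n ⊓ U) := fun n => by
      induction n with
      | zero => simpa [orbitImage, orbitCore] using hU.normalOrNormalizes
      | succ n ih => rw [orbitImage_succ]; exact (ih.map hstable).inf hU.normalOrNormalizes
    exact NormalOrNormalizes.iInf this
  have hidx := relIndex_eq_mul_of_le hA (hA.map hstable) (backwardCore_le_map hφ hU.isCompact)
  rw [relIndex_map_backwardCore hφ hU.isCompact hα hN] at hidx
  rw [hidx, Nat.cast_mul, ENNReal.log_mul_add]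
  exact add_le_add (log_relIndex_backwardCore_inf_le hφ hclosed hstable hker hH hU)
    -- Finiteness of the quotient index is read off from the factorization of `α ≠ 0`.
    (log_relIndex_backwardCore_sup_le hφ hclosed hstable hH hU hA
      (right_ne_zero_of_mul (hidx ▸ hα)))

end AdditionTheorem

theorem mainTheorem1 {G : Type*} [Group G] [TopologicalSpace G] [IsTopologicalGroup G]
    [T2Space G] [LocallyCompactSpace G] [TotallyDisconnectedSpace G]
    (φ : G →* G) (hφ : Continuous φ)
    (H : Subgroup G) (hclosed : IsClosed (H : Set G))
    (hstable : H.map φ = H) (hker : φ.ker ≤ H)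
    (hH : H.Normal ∨ IsCompact (H : Set G)) :
    @hoodEntropy G (IsTopologicalGroup.leftUniformSpace G) φ =
      @hoodEntropy H (IsTopologicalGroup.leftUniformSpace H) (restrictMap φ H hstable.le) +
      @hoodEntropy (G ⧸ H) (quotientLeftUniformSpace H hH) (quotientMap φ H hstable.le) :=
  (hoodEntropy_le_add hφ hclosed hstable hker hH).antisymm
    (hoodEntropy_add_le hφ hclosed hstable.le hH)
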